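/- All logarithms are to base $2$. A function $f\colon\{0,1\}^m\to\{0,1\}^n$ has decision depth $d$ if each of its output bits is computed by a decision tree making at most $d$ adaptive queries to the input bits; it samples the distribution of $f(\mathbf y)$ for uniform $\mathbf y\in\{0,1\}^m$. Let $\mathbf U_k^n$ be the uniform distribution on the strings in $\{0,1\}^n$ of Hamming weight $k$. A distribution $S$ is $\delta$-far from $T$ if their statistical distance $\Delta(S,T)=\frac12\sum_a|S(a)-T(a)|$ is at least $\delta$. There are constants $\tau'>0$ and $c>0$ such that for every $\epsilon\in(0,1)$ there is $n_0$ such that for all integers $n\ge n_0$, $0\le k\le n$ and $m\ge 0$ and every $f\colon\{0,1\}^m\to\{0,1\}^n$ of decision depth $d$: 1. if $\log n\le k\le 2^{(\log n)^{1-\epsilon}}$ and $d\le\tau'(\log n)^{\epsilon}$, then the distribution sampled by $f$ is $(1-n^{-ck})$-far from $\mathbf U_k^n$; 2. if $k<\log n$ and $d\le\tau'(\log n)^{\epsilon}/\log\log n$, then the distribution sampled by $f$ is $(1-n^{-ck})$-far from $\mathbf U_k^n$. -/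

import Mathlib

/-- Decision trees over `m` input bits: a leaf carries the answer, an inner node queries one input
bit and continues in the first subtree if that bit is `0` and in the second one if it is `1`. -/
inductive DecisionTree (m : ℕ) : Type
  | leaf (b : Bool) : DecisionTree m
  | query (i : Fin m) (t₀ t₁ : DecisionTree m) : DecisionTree m

namespace DecisionTree

/-- The output of a decision tree on the input `x`. -/
def eval {m : ℕ} (x : Fin m → Bool) : DecisionTree m → Bool
  | leaf b => b
  | query i t₀ t₁ => if x i = true then eval x t₁ else eval x t₀

/-- The depth of a decision tree: the largest number of queries on a path from root to leaf. -/
def depth {m : ℕ} : DecisionTree m → ℕ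
  | leaf _ => 0
  | query _ t₀ t₁ => max (depth t₀) (depth t₁) + 1

end DecisionTree

/-- `f` has decision depth `d`: every output bit is computed by a decision tree of depth at most
`d` in the input bits (a decision forest of depth `d`). -/
def HasDecisionDepth {m n : ℕ} (f : (Fin m → Bool) → (Fin n → Bool)) (d : ℕ) : Prop :=
  ∀ j : Fin n, ∃ T : DecisionTree m, T.depth ≤ d ∧ ∀ x : Fin m → Bool, T.eval x = f x j

/-- The Hamming weight of a bit string. -/
def hammingWeight {n : ℕ} (x : Fin n → Bool) : ℕ :=
  (Finset.univ.filter fun i => x i = true).card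

/-- The `k`-slice: all `n`-bit strings of Hamming weight `k`. -/
def hammingSlice (n k : ℕ) : Finset (Fin n → Bool) :=
  Finset.univ.filter fun x => hammingWeight x = k

theorem hammingSlice_nonempty {n k : ℕ} (hk : k ≤ n) : (hammingSlice n k).Nonempty := by
  obtain ⟨s, -, hs⟩ := Finset.exists_subset_card_eq
    (show k ≤ (Finset.univ : Finset (Fin n)).card by simpa using hk)
  refine ⟨fun i => decide (i ∈ s), ?_⟩
  rw [hammingSlice, Finset.mem_filter]
  exact ⟨Finset.mem_univ _, by simp [hammingWeight, hs]⟩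

/-- The uniform distribution `U_k^n` on the `n`-bit strings of Hamming weight `k`. -/
noncomputable def uniformSlice (n k : ℕ) (hk : k ≤ n) : PMF (Fin n → Bool) :=
  PMF.uniformOfFinset (hammingSlice n k) (hammingSlice_nonempty hk)

/-- The distribution sampled by `f`: its output on uniformly random input bits. -/
noncomputable def samplerOutput {m n : ℕ} (f : (Fin m → Bool) → (Fin n → Bool)) :
    PMF (Fin n → Bool) :=
  (PMF.uniformOfFintype (Fin m → Bool)).map f

/-- The statistical (total variation) distance of two distributions on a finite set. -/
noncomputable def statDist {α : Type*} [Fintype α] (p q : PMF α) : ℝ :=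
  (1 / 2) * ∑ a : α, |(p a).toReal - (q a).toReal|

/-- `p` is `δ`-far from `q`, i.e. not at statistical distance less than `δ`. -/
def IsFar {α : Type*} [Fintype α] (δ : ℝ) (p q : PMF α) : Prop :=
  δ ≤ statDist p q

/-!
Write `l = log n` and let `D` exceed the decision depth by one. An output bit of a forest of depth at
most `D` is the disjunction of at most `2 ^ D` terms, each of which fixes at most `D` input bits
(`DecisionTree.exists_terms`). The idea is that a shallow forest cannot have many outputs that become
`1` without often having far more than `k` ones at the same time.

The heart is a substitute for a robust sunflower lemma, `exists_term_expect_few_le`: among at least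
`4 ^ D * R ^ (D + 1)` terms for distinct outputs there is one that is true together with at most
`k - 1` others with probability at most `2 ^ k * exp (-R / (16 D))`. To find it, fix an input `w`
that satisfies many of the terms and measure inputs relative to `w`, so that the terms become sets
`V j` of bits that have to be `1`. Take a set `K` that maximizes `#{j | K ⊆ V j} * R ^ #K`. The
sets `V j \ K` with `K ⊆ V j` form a spread family, and it is unlikely that at most `k` of them
consist of ones (`expect_few_le_of_spread`). This follows from a weighted form of Janson's inequality
(`expect_avoidance_le`), which in turn rests on Harris' inequality. Any term with `K ⊆ V j` will do.

As long as terms for many outputs are left, discard such a term and pay for it in a union bound over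
all `n * 2 ^ D` terms (`exists_small_set_of_terms`). In the end only the outputs in a set `J` of at most
`4 ^ D * R ^ (D + 1)` coordinates have terms left: apart from a small error, the forest does not
sample a string of weight `k` with a one outside `J`. But the slice gives the strings of weight `k`
supported in `J` a mass of at most `(#J / n) ^ k`, so the two distributions are nearly disjoint
(`statDist_samplerOutput_ge`).

The choice `R = 160 D (k + 1) l` makes the error at most `n ^ (-k / 2)`. Both parameter ranges imply that
`d * log (max k l)` is at most a small multiple of `l`, which makes `4 ^ D * R ^ (D + 1)` at most
`√n` (`isFar_of_exponent_le`).
-/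

open Finset
open scoped BigOperators

/-! ### Correlation inequalities on the Boolean cube -/

/-- The indicator, as a real function on the cube, of the event that all bits in `U` are `1`. -/
def allTrue {ι : Type*} (U : Finset ι) (y : ι → Bool) : ℝ :=
  if ∀ i ∈ U, y i = true then 1 else 0

/-- The involution of the cube that adds the vector `w` modulo `2`. -/
def flipBy {ι : Type*} (w : ι → Bool) : Equiv.Perm (ι → Bool) :=
  Function.Involutive.toPerm (fun y i => xor (w i) (y i)) (fun y => by ext i; simp)

theorem flipBy_apply {ι : Type*} (w y : ι → Bool) (i : ι) : flipBy w y i = xor (w i) (y i) := rfl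

theorem expect_comp_flipBy {ι : Type*} [Fintype ι] [DecidableEq ι] (w : ι → Bool)
    (g : (ι → Bool) → ℝ) : 𝔼 y, g (flipBy w y) = 𝔼 y, g y :=
  Fintype.expect_equiv (flipBy w) _ _ fun _ => rfl

theorem allTrue_nonneg {ι : Type*} (U : Finset ι) (y : ι → Bool) : 0 ≤ allTrue U y := by
  unfold allTrue; split_ifs <;> norm_num

theorem allTrue_le_one {ι : Type*} (U : Finset ι) (y : ι → Bool) : allTrue U y ≤ 1 := by
  unfold allTrue; split_ifs <;> norm_num

theorem allTrue_mul {ι : Type*} [DecidableEq ι] (U V : Finset ι) (y : ι → Bool) :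
    allTrue U y * allTrue V y = allTrue (U ∪ V) y := by
  have h : (∀ i ∈ U ∪ V, y i = true) ↔ (∀ i ∈ U, y i = true) ∧ ∀ i ∈ V, y i = true := by
    simp only [mem_union, or_imp, forall_and]
  rw [allTrue, allTrue, allTrue, if_congr h rfl rfl, ite_and]
  split_ifs <;> norm_num

theorem monotone_allTrue {ι : Type*} (U : Finset ι) : Monotone (allTrue U) := by
  intro y y' h
  unfold allTrue
  split_ifs with h1 h2
  · exact le_rfl
  · exact absurd (fun i hi => h i (h1 i hi)) h2
  · exact zero_le_one
  · exact le_rfl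

theorem expect_allTrue {ι : Type*} [Fintype ι] [DecidableEq ι] (U : Finset ι) :
    𝔼 y, allTrue U y = (1 / 2 : ℝ) ^ #U := by
  have h : ∀ y : ι → Bool, allTrue U y
      = ∏ i, (fun i b => if i ∈ U then (if b = true then (1 : ℝ) else 0) else 1) i (y i) := by
    intro y
    unfold allTrue
    rw [← Finset.prod_filter]
    simp only [filter_mem_eq_inter, univ_inter]
    rw [Finset.prod_ite_zero]
    simp
  rw [Fintype.expect_eq_sum_div_card]
  simp_rw [h]
  have h2 := Finset.prod_univ_sum (fun _ : ι => (univ : Finset Bool))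
    (fun i b => if i ∈ U then (if b = true then (1 : ℝ) else 0) else 1)
  rw [Fintype.piFinset_univ] at h2
  rw [← h2]
  have h3 : ∀ i, (∑ b : Bool, if i ∈ U then (if b = true then (1 : ℝ) else 0) else 1)
      = 2 * (if i ∈ U then (1 / 2 : ℝ) else 1) := by
    intro i
    split_ifs <;> simp
  simp_rw [h3]
  rw [Finset.prod_mul_distrib]
  simp

/-- Harris' inequality for two decreasing functions. -/
theorem expect_mul_le_of_antitone {ι : Type*} [Fintype ι] [DecidableEq ι] {f g : (ι → Bool) → ℝ}
    (hf₀ : 0 ≤ f) (hg₀ : 0 ≤ g) (hf : Antitone f) (hg : Antitone g) :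
    (𝔼 y, f y) * 𝔼 y, g y ≤ 𝔼 y, f y * g y := by
  -- Negating all bits turns decreasing functions into increasing ones.
  have anti : Antitone (flipBy fun _ : ι => true) := by
    intro y y' h i
    have := h i
    simp only [flipBy_apply]
    revert this
    cases y i <;> cases y' i <;> simp
  have key := fkg (μ := fun _ : ι → Bool => (1 : ℝ)) (f := fun y => f (flipBy (fun _ => true) y))
    (g := fun y => g (flipBy (fun _ => true) y)) (fun _ => zero_le_one) (fun y => hf₀ (flipBy _ y))
    (fun y => hg₀ (flipBy _ y)) (hf.comp anti) (hg.comp anti) (fun _ _ => le_rfl)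
  rw [← expect_comp_flipBy (fun _ => true) f, ← expect_comp_flipBy (fun _ => true) g,
    ← expect_comp_flipBy (fun _ => true) fun y => f y * g y]
  simp only [Fintype.expect_eq_sum_div_card]
  simp only [one_mul, sum_const, nsmul_eq_mul, mul_one, card_univ] at key
  have hc : (0 : ℝ) < Fintype.card (ι → Bool) := by exact_mod_cast Fintype.card_pos
  rw [div_mul_div_comm, div_le_div_iff₀ (by positivity) hc]
  nlinarith

/-- Harris' inequality for an increasing and a decreasing function. -/
theorem expect_mul_le_of_monotone_of_antitone {ι : Type*} [Fintype ι] [DecidableEq ι]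
    {f g : (ι → Bool) → ℝ} (hf₁ : f ≤ 1) (hg₀ : 0 ≤ g) (hf : Monotone f) (hg : Antitone g) :
    𝔼 y, f y * g y ≤ (𝔼 y, f y) * 𝔼 y, g y := by
  have key := expect_mul_le_of_antitone (f := fun y => 1 - f y) (g := g)
    (fun y => sub_nonneg.2 (hf₁ y)) hg₀ (fun _ _ h => sub_le_sub_left (hf h) 1) hg
  simp only [sub_mul, one_mul, Finset.expect_sub_distrib, Fintype.expect_const] at key
  linarith

/-- Half of independence: an event on the coordinates in `U` and a decreasing function of the other
coordinates. Flipping the coordinates in `U` makes both factors decreasing, so that Harris'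
inequality applies. -/
theorem pow_mul_expect_le {ι : Type*} [Fintype ι] [DecidableEq ι] (U : Finset ι)
    {g : (ι → Bool) → ℝ} (hg₀ : 0 ≤ g) (hg : Antitone g)
    (hgU : ∀ y y' : ι → Bool, (∀ i ∉ U, y i = y' i) → g y = g y') :
    (1 / 2 : ℝ) ^ #U * 𝔼 y, g y ≤ 𝔼 y, allTrue U y * g y := by
  set w : ι → Bool := fun i => decide (i ∈ U) with hw
  have hgw : ∀ y, g (flipBy w y) = g y := fun y => hgU _ _ fun i hi => by simp [flipBy_apply, hw, hi]
  have anti : Antitone fun y => allTrue U (flipBy w y) := by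
    intro y y' h
    simp only [allTrue]
    split_ifs with h1 h2
    · exact le_rfl
    · refine absurd (fun i hi => ?_) h2
      have h3 := h1 i hi
      have h4 := h i
      simp only [flipBy_apply, hw, hi, decide_true, Bool.true_xor, Bool.not_eq_true'] at h3 ⊢
      rw [h3] at h4
      exact le_bot_iff.1 h4
    · exact zero_le_one
    · exact le_rfl
  have key := expect_mul_le_of_antitone (fun y => allTrue_nonneg U (flipBy w y)) hg₀ anti hg
  rw [expect_comp_flipBy w (allTrue U), expect_allTrue] at key
  refine key.trans_eq ?_
  rw [← expect_comp_flipBy w fun y => allTrue U y * g y]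
  simp_rw [hgw]

/-! ### A weighted Janson inequality -/

theorem one_sub_sum_le_prod {κ : Type*} (S : Finset κ) (x : κ → ℝ) (h₀ : ∀ j ∈ S, 0 ≤ x j)
    (h₁ : ∀ j ∈ S, x j ≤ 1) : 1 - ∑ j ∈ S, x j ≤ ∏ j ∈ S, (1 - x j) := by
  classical
  induction S using Finset.induction_on with
  | empty => simp
  | insert a S ha ih =>
    rw [sum_insert ha, prod_insert ha]
    have ih := ih (fun j hj => h₀ j (mem_insert_of_mem hj)) fun j hj => h₁ j (mem_insert_of_mem hj)
    have hp : ∏ j ∈ S, (1 - x j) ≤ 1 := prod_le_one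
      (fun j hj => sub_nonneg.2 (h₁ j (mem_insert_of_mem hj)))
      fun j hj => sub_le_self _ (h₀ j (mem_insert_of_mem hj))
    have := h₀ a (mem_insert_self a S)
    nlinarith

/-- The product `∏ (1 - q j · 1[U j])` that Janson's inequality bounds. It is `1` where no event
`U j` occurs; if the `q j` are small, it is not much smaller where only few of them occur. -/
def avoidance {ι κ : Type*} (U : κ → Finset ι) (q : κ → ℝ) (S : Finset κ) (y : ι → Bool) : ℝ :=
  ∏ j ∈ S, (1 - q j * allTrue (U j) y)

theorem avoidance_factor_mem {ι κ : Type*} {U : κ → Finset ι} {q : κ → ℝ} (hq₀ : ∀ j, 0 ≤ q j)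
    (hq₁ : ∀ j, q j ≤ 1) (j : κ) (y : ι → Bool) :
    0 ≤ q j * allTrue (U j) y ∧ q j * allTrue (U j) y ≤ 1 :=
  ⟨mul_nonneg (hq₀ j) (allTrue_nonneg _ _),
    mul_le_one₀ (hq₁ j) (allTrue_nonneg _ _) (allTrue_le_one _ _)⟩

theorem avoidance_nonneg {ι κ : Type*} {U : κ → Finset ι} {q : κ → ℝ} (hq₀ : ∀ j, 0 ≤ q j)
    (hq₁ : ∀ j, q j ≤ 1) (S : Finset κ) (y : ι → Bool) : 0 ≤ avoidance U q S y :=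
  prod_nonneg fun j _ => sub_nonneg.2 (avoidance_factor_mem hq₀ hq₁ j y).2

theorem antitone_avoidance {ι κ : Type*} {U : κ → Finset ι} {q : κ → ℝ} (hq₀ : ∀ j, 0 ≤ q j)
    (hq₁ : ∀ j, q j ≤ 1) (S : Finset κ) : Antitone (avoidance U q S) := fun _ y' h =>
  prod_le_prod (fun j _ => sub_nonneg.2 (avoidance_factor_mem hq₀ hq₁ j y').2) fun j _ =>
    sub_le_sub_left (mul_le_mul_of_nonneg_left (monotone_allTrue _ h) (hq₀ j)) 1

/-- The step of Janson's inequality: conditioning on the avoidance of the events in `S` lowers the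
probability of `U a` at most by its overlap with the events that share a coordinate with it. -/
theorem expect_allTrue_mul_avoidance_ge {ι κ : Type*} [Fintype ι] [DecidableEq ι]
    {U : κ → Finset ι} {q : κ → ℝ} (hq₀ : ∀ j, 0 ≤ q j) (hq₁ : ∀ j, q j ≤ 1) (S : Finset κ)
    (a : κ) :
    ((1 / 2 : ℝ) ^ #(U a) - ∑ j ∈ S with ¬ Disjoint (U a) (U j), q j * (1 / 2) ^ #(U a ∪ U j))
      * 𝔼 y, avoidance U q S y ≤ 𝔼 y, allTrue (U a) y * avoidance U q S y := by
  set A := S.filter fun j => Disjoint (U a) (U j)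
  set B := S.filter fun j => ¬ Disjoint (U a) (U j)
  have hmem := @avoidance_factor_mem ι κ U q hq₀ hq₁
  have hsplit : ∀ y, avoidance U q S y = avoidance U q A y * avoidance U q B y := fun y =>
    (prod_filter_mul_prod_filter_not S _ _).symm
  have hB₁ : ∀ y, avoidance U q B y ≤ 1 := fun y => prod_le_one
    (fun j _ => sub_nonneg.2 (hmem j y).2) fun j _ => sub_le_self _ (hmem j y).1
  have hA₀ : ∀ y, 0 ≤ avoidance U q A y := avoidance_nonneg hq₀ hq₁ A
  have hEA : 𝔼 y, avoidance U q S y ≤ 𝔼 y, avoidance U q A y := expect_le_expect fun y _ => by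
    rw [hsplit]; exact mul_le_of_le_one_right (hA₀ y) (hB₁ y)
  have hES : 0 ≤ 𝔼 y, avoidance U q S y := expect_nonneg fun y _ => avoidance_nonneg hq₀ hq₁ S y
  have hpos : 0 ≤ 𝔼 y, allTrue (U a) y * avoidance U q S y := expect_nonneg fun y _ =>
    mul_nonneg (allTrue_nonneg _ _) (avoidance_nonneg hq₀ hq₁ S y)
  have hindep : (1 / 2 : ℝ) ^ #(U a) * 𝔼 y, avoidance U q A y
      ≤ 𝔼 y, allTrue (U a) y * avoidance U q A y := by
    refine pow_mul_expect_le (U a) hA₀ (antitone_avoidance hq₀ hq₁ A) fun y y' h => ?_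
    refine prod_congr rfl fun j hj => ?_
    have hdisj : Disjoint (U a) (U j) := (mem_filter.1 hj).2
    have : ∀ i ∈ U j, y i = y' i := fun i hi => h i fun hi' => disjoint_left.1 hdisj hi' hi
    have : allTrue (U j) y = allTrue (U j) y' := by
      unfold allTrue
      congr 1
      exact propext (forall₂_congr fun i hi => by rw [this i hi])
    rw [this]
  have hpair : ∀ j, 𝔼 y, allTrue (U a ∪ U j) y * avoidance U q A y
      ≤ (1 / 2 : ℝ) ^ #(U a ∪ U j) * 𝔼 y, avoidance U q A y := fun j => by
    rw [← expect_allTrue]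
    exact expect_mul_le_of_monotone_of_antitone (fun y => allTrue_le_one _ y) hA₀
      (monotone_allTrue _) (antitone_avoidance hq₀ hq₁ A)
  have hpoint : ∀ y, allTrue (U a) y * avoidance U q A y
      - ∑ j ∈ B, q j * (allTrue (U a ∪ U j) y * avoidance U q A y)
      ≤ allTrue (U a) y * avoidance U q S y := fun y => by
    have h1 := one_sub_sum_le_prod B (fun j => q j * allTrue (U j) y) (fun j _ => (hmem j y).1)
      fun j _ => (hmem j y).2
    have h2 := mul_le_mul_of_nonneg_left h1 (mul_nonneg (allTrue_nonneg (U a) y) (hA₀ y))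
    rw [hsplit]
    refine (le_of_eq ?_).trans (h2.trans_eq (mul_assoc _ _ _))
    rw [mul_sub, mul_one, mul_sum]
    congr 1
    refine sum_congr rfl fun j _ => ?_
    rw [← allTrue_mul]; ring
  have hE := expect_le_expect fun y (_ : y ∈ (univ : Finset (ι → Bool))) => hpoint y
  rw [expect_sub_distrib, expect_sum_comm] at hE
  simp_rw [← mul_expect] at hE
  have hsum : ∑ j ∈ B, q j * 𝔼 y, allTrue (U a ∪ U j) y * avoidance U q A y
      ≤ (∑ j ∈ B, q j * (1 / 2 : ℝ) ^ #(U a ∪ U j)) * 𝔼 y, avoidance U q A y := by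
    rw [sum_mul]
    refine sum_le_sum fun j _ => ?_
    rw [mul_assoc]
    exact mul_le_mul_of_nonneg_left (hpair j) (hq₀ j)
  rcases le_total 0 ((1 / 2 : ℝ) ^ #(U a) - ∑ j ∈ B, q j * (1 / 2) ^ #(U a ∪ U j)) with hc | hc
  · refine (mul_le_mul_of_nonneg_left hEA hc).trans ?_
    rw [sub_mul]
    linarith
  · exact (mul_nonpos_of_nonpos_of_nonneg hc hES).trans hpos

/-- Janson's inequality with weights `q j`. In the correlation term all ordered pairs are summed. -/
theorem expect_avoidance_le {ι κ : Type*} [Fintype ι] [DecidableEq ι]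
    {U : κ → Finset ι} {q : κ → ℝ} (hq₀ : ∀ j, 0 ≤ q j) (hq₁ : ∀ j, q j ≤ 1) (S : Finset κ) :
    𝔼 y, avoidance U q S y ≤ Real.exp (-∑ j ∈ S, q j * (1 / 2) ^ #(U j)
      + ∑ i ∈ S, ∑ j ∈ S with ¬ Disjoint (U i) (U j), q i * (q j * (1 / 2) ^ #(U i ∪ U j))) := by
  classical
  induction S using Finset.induction_on with
  | empty => simp [avoidance]
  | insert a S ha ih =>
    set c := (1 / 2 : ℝ) ^ #(U a)
      - ∑ j ∈ S with ¬ Disjoint (U a) (U j), q j * (1 / 2) ^ #(U a ∪ U j) with hc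
    have hstep := expect_allTrue_mul_avoidance_ge hq₀ hq₁ S a (U := U)
    rw [← hc] at hstep
    have hES : 0 ≤ 𝔼 y, avoidance U q S y := expect_nonneg fun y _ => avoidance_nonneg hq₀ hq₁ S y
    have heq : 𝔼 y, avoidance U q (insert a S) y
        = 𝔼 y, avoidance U q S y - q a * 𝔼 y, allTrue (U a) y * avoidance U q S y := by
      rw [mul_expect, ← expect_sub_distrib]
      refine expect_congr rfl fun y _ => ?_
      rw [avoidance, prod_insert ha, avoidance]
      ring
    have h1 : 𝔼 y, avoidance U q (insert a S) y ≤ Real.exp (-(q a * c)) * 𝔼 y, avoidance U q S y := by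
      rw [heq]
      have h2 := Real.add_one_le_exp (-(q a * c))
      have h3 := mul_le_mul_of_nonneg_left hstep (hq₀ a)
      nlinarith [mul_le_mul_of_nonneg_right h2 hES]
    refine h1.trans ((mul_le_mul_of_nonneg_left ih (Real.exp_pos _).le).trans ?_)
    rw [← Real.exp_add]
    refine Real.exp_le_exp.2 ?_
    have hnn : ∀ i j, 0 ≤ q i * (q j * (1 / 2 : ℝ) ^ #(U i ∪ U j)) := fun i j =>
      mul_nonneg (hq₀ i) (mul_nonneg (hq₀ j) (by positivity))
    have hrow : ∀ i, ∑ j ∈ S with ¬ Disjoint (U i) (U j), q i * (q j * (1 / 2) ^ #(U i ∪ U j))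
        ≤ ∑ j ∈ insert a S with ¬ Disjoint (U i) (U j), q i * (q j * (1 / 2) ^ #(U i ∪ U j)) :=
      fun i => sum_le_sum_of_subset_of_nonneg (filter_subset_filter _ (subset_insert a S))
        fun j _ _ => hnn i j
    rw [sum_insert ha, sum_insert ha]
    have hrows := sum_le_sum fun i (_ : i ∈ S) => hrow i
    have hra := hrow a
    rw [← mul_sum] at hra
    rw [hc]
    linarith

/-! ### Spread families of terms -/

/-- In a spread family, a given member overlaps little with the others. -/
theorem sum_two_pow_inter_le {ι κ : Type*} [DecidableEq ι] {U : κ → Finset ι}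
    {G : Finset κ} {D : ℕ} {R : ℝ} (hD : 1 ≤ D) (hDR : (D : ℝ) ≤ R) (hU : ∀ j, #(U j) ≤ D)
    (hspread : ∀ L : Finset ι, L.Nonempty → (#{j ∈ G | L ⊆ U j} : ℝ) * R ^ #L ≤ #G) (i : κ) :
    ∑ j ∈ G with ¬ Disjoint (U i) (U j), (2 : ℝ) ^ #(U i ∩ U j) ≤ 4 * D / R * #G := by
  have hR : (0 : ℝ) < R := lt_of_lt_of_le (by exact_mod_cast hD) hDR
  set P := (U i).powerset.erase ∅ with hP
  -- `2 ^ #I` is at most twice the number of nonempty subsets of a nonempty `I`.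
  have h1 : ∀ j ∈ G.filter fun j => ¬ Disjoint (U i) (U j),
      (2 : ℝ) ^ #(U i ∩ U j) ≤ 2 * ∑ L ∈ P, if L ⊆ U j then (1 : ℝ) else 0 := by
    intro j hj
    have hne : (U i ∩ U j).Nonempty := not_disjoint_iff_nonempty_inter.1 (mem_filter.1 hj).2
    have hsub : (U i ∩ U j).powerset.erase ∅ ⊆ P.filter fun L => L ⊆ U j := by
      intro L hL
      simp only [hP, mem_filter, mem_erase, mem_powerset, subset_inter_iff] at hL ⊢
      tauto
    have hcard := card_le_card hsub
    rw [card_erase_of_mem (empty_mem_powerset _), card_powerset] at hcard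
    have h2 : 2 ≤ 2 ^ #(U i ∩ U j) := by
      simpa using Nat.pow_le_pow_right (n := 2) (by norm_num) (card_pos.2 hne)
    rw [sum_boole]
    exact_mod_cast (by omega : 2 ^ #(U i ∩ U j) ≤ 2 * #(P.filter fun L => L ⊆ U j))
  have h3 : ∀ L ∈ P, ∑ j ∈ G, (if L ⊆ U j then (1 : ℝ) else 0) ≤ #G * (1 / R) ^ #L := by
    intro L hL
    have hLne : L.Nonempty := nonempty_iff_ne_empty.2 (mem_erase.1 hL).1
    rw [sum_boole, one_div, inv_pow, ← div_eq_mul_inv, le_div_iff₀ (pow_pos hR _)]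
    exact hspread L hLne
  have h4 : ∑ L ∈ P, (1 / R) ^ #L ≤ 2 * D / R := by
    have h5 : ∑ L ∈ (U i).powerset, (1 / R) ^ #L = (1 / R + 1) ^ #(U i) := by
      rw [← sum_pow_mul_eq_add_pow]
      simp
    have h6 : ∑ L ∈ P, (1 / R) ^ #L = (1 / R + 1) ^ #(U i) - 1 := by
      rw [← h5, ← add_sum_erase _ _ (empty_mem_powerset (U i))]
      simp [hP]
    have hx : |(D : ℝ) / R| ≤ 1 := by
      rw [abs_of_nonneg (by positivity)]
      exact (div_le_one hR).2 hDR
    have h7 := (abs_le.1 (Real.abs_exp_sub_one_le hx)).2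
    rw [abs_of_nonneg (by positivity)] at h7
    have h8 : (1 / R + 1) ^ #(U i) ≤ Real.exp (D / R) := by
      calc (1 / R + 1) ^ #(U i) ≤ (1 / R + 1) ^ D :=
            pow_le_pow_right₀ (by linarith [one_div_pos.2 hR]) (hU i)
        _ ≤ Real.exp (1 / R) ^ D := pow_le_pow_left₀ (by positivity) (Real.add_one_le_exp _) _
        _ = Real.exp (D / R) := by rw [← Real.exp_nat_mul]; congr 1; ring
    rw [h6, mul_div_assoc]
    linarith
  calc ∑ j ∈ G with ¬ Disjoint (U i) (U j), (2 : ℝ) ^ #(U i ∩ U j)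
      ≤ ∑ j ∈ G with ¬ Disjoint (U i) (U j), 2 * ∑ L ∈ P, (if L ⊆ U j then (1 : ℝ) else 0) :=
        sum_le_sum h1
    _ ≤ ∑ j ∈ G, 2 * ∑ L ∈ P, (if L ⊆ U j then (1 : ℝ) else 0) :=
        sum_le_sum_of_subset_of_nonneg (filter_subset _ _) fun j _ _ =>
          mul_nonneg zero_le_two (sum_nonneg fun L _ => by split_ifs <;> norm_num)
    _ = 2 * ∑ L ∈ P, ∑ j ∈ G, (if L ⊆ U j then (1 : ℝ) else 0) := by
        rw [← mul_sum, sum_comm]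
    _ ≤ 2 * ∑ L ∈ P, #G * (1 / R) ^ #L :=
        mul_le_mul_of_nonneg_left (sum_le_sum h3) zero_le_two
    _ = 2 * #G * ∑ L ∈ P, (1 / R) ^ #L := by rw [← mul_sum]; ring
    _ ≤ 2 * #G * (2 * D / R) := mul_le_mul_of_nonneg_left h4 (by positivity)
    _ = 4 * D / R * #G := by ring

/-- If all weights are at most `1 / 2`, then `avoidance` is at least `2 ^ (-k)` wherever at most `k`
events occur. -/
theorem expect_few_le_two_pow_mul {ι κ : Type*} [Fintype ι] [DecidableEq ι]
    {U : κ → Finset ι} {q : κ → ℝ} (hq₀ : ∀ j, 0 ≤ q j) (hq : ∀ j, q j ≤ 1 / 2) (G : Finset κ)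
    (k : ℕ) :
    𝔼 y : ι → Bool, (if #{j ∈ G | ∀ i ∈ U j, y i = true} ≤ k then (1 : ℝ) else 0)
      ≤ 2 ^ k * 𝔼 y, avoidance U q G y := by
  rw [mul_expect]
  refine expect_le_expect fun y _ => ?_
  have hq₁ : ∀ j, q j ≤ 1 := fun j => (hq j).trans (by norm_num)
  split_ifs with h
  · have h1 : ∏ j ∈ G, (if ∀ i ∈ U j, y i = true then (1 / 2 : ℝ) else 1) ≤ avoidance U q G y := by
      refine prod_le_prod (fun j _ => by split_ifs <;> norm_num) fun j _ => ?_
      unfold allTrue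
      split_ifs
      · linarith [hq j]
      · simp
    rw [← prod_filter, prod_const] at h1
    have h2 : (1 / 2 : ℝ) ^ k ≤ (1 / 2) ^ #{j ∈ G | ∀ i ∈ U j, y i = true} :=
      pow_le_pow_of_le_one (by norm_num) (by norm_num) h
    calc (1 : ℝ) = 2 ^ k * (1 / 2) ^ k := by rw [← mul_pow]; norm_num
      _ ≤ 2 ^ k * avoidance U q G y := mul_le_mul_of_nonneg_left (h2.trans h1) (by positivity)
  · exact mul_nonneg (by positivity) (avoidance_nonneg hq₀ hq₁ G y)

/-- In a large spread family of small sets, it is very unlikely that at most `k` of the sets consist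
of ones only. -/
theorem expect_few_le_of_spread {ι κ : Type*} [Fintype ι] [DecidableEq ι] {U : κ → Finset ι}
    {G : Finset κ} {D : ℕ} {R : ℝ} (hD : 1 ≤ D) (hDR : (D : ℝ) ≤ R) (hU : ∀ j, #(U j) ≤ D)
    (hspread : ∀ L : Finset ι, L.Nonempty → (#{j ∈ G | L ⊆ U j} : ℝ) * R ^ #L ≤ #G)
    (hG : R * 2 ^ D ≤ #G) (k : ℕ) :
    𝔼 y : ι → Bool, (if #{j ∈ G | ∀ i ∈ U j, y i = true} ≤ k then (1 : ℝ) else 0)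
      ≤ 2 ^ k * Real.exp (-(R / (16 * D))) := by
  have hD₁ : (1 : ℝ) ≤ D := by exact_mod_cast hD
  have hD' : (0 : ℝ) < D := by linarith
  have hR : (0 : ℝ) < R := hD'.trans_le hDR
  have hG' : (0 : ℝ) < #G := lt_of_lt_of_le (by positivity) hG
  -- This `l` minimizes the bound `-l * #G + l ^ 2 * (4 * D / R) * #G ^ 2` of the exponent.
  set l : ℝ := R / (8 * D * #G) with hl
  have hl₀ : 0 < l := by positivity
  have hq₀ : ∀ j, 0 ≤ l * 2 ^ #(U j) := fun j => by positivity
  have hq : ∀ j, l * 2 ^ #(U j) ≤ 1 / 2 := fun j => by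
    have h1 : (2 : ℝ) ^ #(U j) ≤ 2 ^ D := pow_le_pow_right₀ (by norm_num) (hU j)
    have h2 : l * 2 ^ D ≤ 1 / 2 := by
      rw [hl, div_mul_eq_mul_div, div_le_iff₀ (by positivity)]
      nlinarith
    exact (mul_le_mul_of_nonneg_left h1 hl₀.le).trans h2
  refine (expect_few_le_two_pow_mul hq₀ hq G k).trans (mul_le_mul_of_nonneg_left ?_ (by positivity))
  refine (expect_avoidance_le hq₀ (fun j => (hq j).trans (by norm_num)) G).trans
    (Real.exp_le_exp.2 ?_)
  have h1 : ∑ j ∈ G, l * 2 ^ #(U j) * (1 / 2) ^ #(U j) = l * #G := by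
    have : ∀ j ∈ G, l * 2 ^ #(U j) * (1 / 2) ^ #(U j) = l := fun j _ => by
      rw [mul_assoc, ← mul_pow]; norm_num
    rw [sum_congr rfl this, sum_const, nsmul_eq_mul, mul_comm]
  have h2 : ∀ i j, l * 2 ^ #(U i) * (l * 2 ^ #(U j) * (1 / 2) ^ #(U i ∪ U j))
      = l ^ 2 * 2 ^ #(U i ∩ U j) := fun i j => by
    have h3 : (2 : ℝ) ^ #(U i) * 2 ^ #(U j) = 2 ^ #(U i ∪ U j) * 2 ^ #(U i ∩ U j) := by
      rw [← pow_add, ← pow_add, card_union_add_card_inter]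
    have h4 : (2 : ℝ) ^ #(U i ∪ U j) * (1 / 2) ^ #(U i ∪ U j) = 1 := by rw [← mul_pow]; norm_num
    linear_combination l ^ 2 * (1 / 2) ^ #(U i ∪ U j) * h3 + l ^ 2 * 2 ^ #(U i ∩ U j) * h4
  have h5 : ∑ i ∈ G, ∑ j ∈ G with ¬ Disjoint (U i) (U j),
      l * 2 ^ #(U i) * (l * 2 ^ #(U j) * (1 / 2) ^ #(U i ∪ U j))
      ≤ ∑ i ∈ G, l ^ 2 * (4 * D / R * #G) := sum_le_sum fun i _ => by
    simp_rw [h2]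
    rw [← mul_sum]
    exact mul_le_mul_of_nonneg_left (sum_two_pow_inter_le hD hDR hU hspread i) (by positivity)
  rw [sum_const, nsmul_eq_mul] at h5
  rw [h1]
  refine (add_le_add_right h5 _).trans_eq ?_
  rw [hl]
  field_simp
  ring

theorem expect_agree {ι : Type*} [Fintype ι] [DecidableEq ι] (V : Finset ι) (a : ι → Bool) :
    𝔼 y : ι → Bool, (if ∀ i ∈ V, y i = a i then (1 : ℝ) else 0) = (1 / 2) ^ #V := by
  rw [← expect_allTrue, ← expect_comp_flipBy (fun i => !a i) fun y => if ∀ i ∈ V, y i = a i then _ else _]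
  refine expect_congr rfl fun y _ => ?_
  have h : (∀ i ∈ V, flipBy (fun i => !a i) y i = a i) ↔ ∀ i ∈ V, y i = true :=
    forall₂_congr fun i _ => by rw [flipBy_apply]; cases y i <;> cases a i <;> simp
  simp only [allTrue, h]
  congr

/-- The substitute for a robust sunflower: among many small terms, each of which demands that `y`
agrees with `a j` on `V j`, there is one that is very unlikely to hold together with at most `k - 1`
others. Some `w` agrees with many of the terms; among these, the ones that contain a set `K` which is
extremal for the density of its link form a spread family outside `K`. -/
theorem exists_term_expect_few_le {ι κ : Type*} [Fintype ι] [DecidableEq ι] {J : Finset κ}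
    {V : κ → Finset ι} (a : κ → ι → Bool) {D : ℕ} {R : ℝ} (hD : 1 ≤ D) (hDR : (D : ℝ) ≤ R)
    (hV : ∀ j, #(V j) ≤ D) (hJ : 4 ^ D * R ^ (D + 1) ≤ #J) (k : ℕ) :
    ∃ j₀ ∈ J, 𝔼 y : ι → Bool, (if (∀ i ∈ V j₀, y i = a j₀ i) ∧
        #{j ∈ J | ∀ i ∈ V j, y i = a j i} ≤ k then (1 : ℝ) else 0)
      ≤ 2 ^ k * Real.exp (-(R / (16 * D))) := by
  have hR₁ : (1 : ℝ) ≤ R := le_trans (by exact_mod_cast hD) hDR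
  have hR : (0 : ℝ) < R := by linarith
  obtain ⟨w, hw⟩ : ∃ w : ι → Bool, (#J : ℝ) / 2 ^ D ≤ #{j ∈ J | ∀ i ∈ V j, w i = a j i} := by
    have h1 : (#J : ℝ) / 2 ^ D
        ≤ 𝔼 w : ι → Bool, ∑ j ∈ J, (if ∀ i ∈ V j, w i = a j i then (1 : ℝ) else 0) := by
      rw [expect_sum_comm]
      simp_rw [expect_agree]
      rw [div_eq_mul_inv, ← nsmul_eq_mul, ← sum_const]
      refine sum_le_sum fun j _ => ?_
      rw [← inv_pow, ← one_div]
      exact pow_le_pow_of_le_one (by norm_num) (by norm_num) (hV j)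
    obtain ⟨w, -, hw⟩ := exists_le_of_le_expect univ_nonempty h1
    exact ⟨w, by rwa [sum_boole] at hw⟩
  set Jw := J.filter fun j => ∀ i ∈ V j, w i = a j i with hJw
  obtain ⟨K, -, hK⟩ := exists_max_image univ
    (fun K : Finset ι => (#{j ∈ Jw | K ⊆ V j} : ℝ) * R ^ #K) univ_nonempty
  set G := Jw.filter fun j => K ⊆ V j with hGdef
  have hJw' : 2 ^ D * R ^ (D + 1) ≤ (#Jw : ℝ) := by
    refine le_trans ?_ hw
    rw [le_div_iff₀ (by positivity)]
    refine le_trans (le_of_eq ?_) hJ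
    rw [show (4 : ℝ) = 2 * 2 by norm_num, mul_pow]
    ring
  have hGK : (#Jw : ℝ) ≤ #G * R ^ #K := by simpa using hK ∅ (mem_univ _)
  have hGne : G.Nonempty := by
    rw [nonempty_iff_ne_empty]
    intro h
    rw [h] at hGK
    have : (0 : ℝ) < 2 ^ D * R ^ (D + 1) := by positivity
    simp at hGK
    rw [hGK] at hJw'
    simp at hJw'
    linarith
  obtain ⟨j₀, hj₀⟩ := hGne
  have hj₀' := mem_filter.1 hj₀
  have hj₀w := mem_filter.1 hj₀'.1
  have hG : R * 2 ^ D ≤ #G := by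
    have h1 : R ^ #K ≤ R ^ D := pow_le_pow_right₀ hR₁ ((card_le_card hj₀'.2).trans (hV j₀))
    have h2 := hJw'.trans (hGK.trans (mul_le_mul_of_nonneg_left h1 (Nat.cast_nonneg _)))
    refine le_of_mul_le_mul_right (le_trans (le_of_eq ?_) h2) (pow_pos hR D)
    ring
  have hspread : ∀ L : Finset ι, L.Nonempty →
      (#{j ∈ G | L ⊆ V j \ K} : ℝ) * R ^ #L ≤ #G := by
    intro L _
    rcases (G.filter fun j => L ⊆ V j \ K).eq_empty_or_nonempty with he | ⟨j, hj⟩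
    · rw [he]; simp
    · have hdisj : Disjoint K L :=
        (disjoint_sdiff (s := K) (t := V j)).mono_right (mem_filter.1 hj).2
      have hsub : (G.filter fun j => L ⊆ V j \ K) ⊆ Jw.filter fun j => K ∪ L ⊆ V j := by
        intro j hj
        simp only [hGdef, mem_filter] at hj ⊢
        exact ⟨hj.1.1, union_subset hj.1.2 (hj.2.trans sdiff_subset)⟩
      have h1 := hK (K ∪ L) (mem_univ _)
      rw [card_union_of_disjoint hdisj, pow_add] at h1
      have h2 : (#{j ∈ G | L ⊆ V j \ K} : ℝ) ≤ #{j ∈ Jw | K ∪ L ⊆ V j} := by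
        exact_mod_cast card_le_card hsub
      refine le_of_mul_le_mul_right ?_ (pow_pos hR #K)
      refine le_trans ?_ h1
      rw [mul_assoc, mul_comm (R ^ #L)]
      exact mul_le_mul_of_nonneg_right h2 (by positivity)
  refine ⟨j₀, hj₀w.1, le_trans ?_ (expect_few_le_of_spread hD hDR
    (fun j => (card_le_card sdiff_subset).trans (hV j)) hspread hG k)⟩
  rw [← expect_comp_flipBy fun i => !w i]
  refine expect_le_expect fun y _ => ?_
  split_ifs with h1 h2
  · exact le_rfl
  · refine absurd (le_trans (card_le_card fun j hj => ?_) h1.2) h2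
    obtain ⟨hjG, hj⟩ := mem_filter.1 hj
    have hjw := mem_filter.1 (mem_filter.1 hjG).1
    refine mem_filter.2 ⟨hjw.1, fun i hi => ?_⟩
    rw [← hjw.2 i hi]
    by_cases hiK : i ∈ K
    · rw [hj₀w.2 i (hj₀'.2 hiK), h1.1 i (hj₀'.2 hiK)]
    · have h3 := hj i (mem_sdiff.2 ⟨hi, hiK⟩)
      rw [flipBy_apply, h3]
      simp
  · exact zero_le_one
  · exact le_rfl

/-! ### Decision forests -/

/-- A union bound over terms. Repeatedly discarding a term that rarely holds on inputs with few `1`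
outputs leaves terms for a small set `J` of outputs only. Here `W y` is the set of outputs that are
`1` on `y`, and `(j, V, a) ∈ T` is a term that implies `j ∈ W y`. -/
theorem exists_small_set_of_terms {ι κ : Type*} [Fintype ι] [DecidableEq ι] [DecidableEq κ]
    {W : (ι → Bool) → Finset κ} {D : ℕ} {R : ℝ} (hD : 1 ≤ D) (hDR : (D : ℝ) ≤ R) (k : ℕ)
    (T : Finset (κ × Finset ι × (ι → Bool))) (hT : ∀ p ∈ T, #p.2.1 ≤ D)
    (hW : ∀ p ∈ T, ∀ y : ι → Bool, (∀ i ∈ p.2.1, y i = p.2.2 i) → p.1 ∈ W y) :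
    ∃ J : Finset κ, (#J : ℝ) < 4 ^ D * R ^ (D + 1) ∧
      𝔼 y : ι → Bool, (if #(W y) ≤ k ∧ ∃ p ∈ T, p.1 ∉ J ∧ ∀ i ∈ p.2.1, y i = p.2.2 i
        then (1 : ℝ) else 0) ≤ #T * (2 ^ k * Real.exp (-(R / (16 * D)))) := by
  induction T using Finset.strongInduction with
  | H T ih =>
    by_cases hsmall : (#(T.image Prod.fst) : ℝ) < 4 ^ D * R ^ (D + 1)
    · refine ⟨_, hsmall, le_trans (expect_le_expect (g := fun _ => 0) fun y _ => ?_) ?_⟩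
      · rw [if_neg]
        rintro ⟨-, p, hp, hpJ, -⟩
        exact hpJ (mem_image_of_mem _ hp)
      · rw [expect_const_zero]; positivity
    · have hex : ∀ j, ∃ t : Finset ι × (ι → Bool), #t.1 ≤ D ∧ (j ∈ T.image Prod.fst → (j, t) ∈ T) := by
        intro j
        by_cases hj : j ∈ T.image Prod.fst
        · obtain ⟨⟨j', t⟩, hp, rfl⟩ := mem_image.1 hj
          exact ⟨t, hT _ hp, fun _ => hp⟩
        · exact ⟨(∅, fun _ => true), by simp, fun h => absurd h hj⟩
      choose t ht htT using hex
      obtain ⟨j₀, hj₀, hrare⟩ := exists_term_expect_few_le (fun j => (t j).2) hD hDR ht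
        (not_lt.1 hsmall) k
      have hp₀ := htT j₀ hj₀
      obtain ⟨J, hJ, hE⟩ := ih _ (erase_ssubset hp₀) (fun p hp => hT p (mem_of_mem_erase hp))
        fun p hp => hW p (mem_of_mem_erase hp)
      refine ⟨J, hJ, ?_⟩
      have hcard : (#T : ℝ) = #(T.erase (j₀, t j₀)) + 1 := by
        exact_mod_cast (card_erase_add_one hp₀).symm
      rw [hcard, add_mul, one_mul]
      refine le_trans ?_ (add_le_add hE hrare)
      rw [← expect_add_distrib]
      refine expect_le_expect fun y _ => ?_
      by_cases hy : #(W y) ≤ k ∧ ∃ p ∈ T, p.1 ∉ J ∧ ∀ i ∈ p.2.1, y i = p.2.2 i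
      · rw [if_pos hy]
        obtain ⟨hk, p, hp, hpJ, hpy⟩ := hy
        by_cases hpp : p = (j₀, t j₀)
        · subst hpp
          have hfew : #{j ∈ T.image Prod.fst | ∀ i ∈ (t j).1, y i = (t j).2 i} ≤ k := by
            refine le_trans (card_le_card fun j hj => ?_) hk
            obtain ⟨hj, hjy⟩ := mem_filter.1 hj
            exact hW _ (htT j hj) y hjy
          rw [if_pos (⟨hpy, hfew⟩ : (∀ i ∈ (t j₀).1, y i = (t j₀).2 i) ∧ _)]
          have : (0 : ℝ) ≤ if #(W y) ≤ k ∧ ∃ p ∈ T.erase (j₀, t j₀), p.1 ∉ J ∧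
              ∀ i ∈ p.2.1, y i = p.2.2 i then 1 else 0 := by split_ifs <;> norm_num
          linarith
        · rw [if_pos ⟨hk, p, mem_erase.2 ⟨hpp, hp⟩, hpJ, hpy⟩]
          have : (0 : ℝ) ≤ if (∀ i ∈ (t j₀).1, y i = (t j₀).2 i) ∧
              #{j ∈ T.image Prod.fst | ∀ i ∈ (t j).1, y i = (t j).2 i} ≤ k then 1 else 0 := by
            split_ifs <;> norm_num
          linarith
      · rw [if_neg hy]
        refine add_nonneg ?_ ?_ <;> split_ifs <;> norm_num

/-- Querying a bit before evaluating a disjunction of terms. -/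
theorem exists_terms_and_bit {m : ℕ} (i : Fin m) (b : Bool)
    (T : Finset (Finset (Fin m) × (Fin m → Bool))) :
    ∃ T' : Finset (Finset (Fin m) × (Fin m → Bool)), #T' ≤ #T ∧
      (∀ d, (∀ p ∈ T, #p.1 ≤ d) → ∀ p ∈ T', #p.1 ≤ d + 1) ∧
      ∀ y : Fin m → Bool, (∃ p ∈ T', ∀ j ∈ p.1, y j = p.2 j) ↔
        y i = b ∧ ∃ p ∈ T, ∀ j ∈ p.1, y j = p.2 j := by
  -- Terms that contradict the answer `b` are dropped.
  refine ⟨(T.filter fun p => i ∈ p.1 → p.2 i = b).image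
    fun p => (insert i p.1, Function.update p.2 i b),
    card_image_le.trans (card_filter_le _ _), fun d hd p hp => ?_, fun y => ⟨?_, ?_⟩⟩
  · obtain ⟨q, hq, rfl⟩ := mem_image.1 hp
    exact (card_insert_le _ _).trans (Nat.succ_le_succ (hd q (mem_filter.1 hq).1))
  · rintro ⟨p, hp, hy⟩
    obtain ⟨q, hq, rfl⟩ := mem_image.1 hp
    obtain ⟨hqT, hq⟩ := mem_filter.1 hq
    have hi : y i = b := by simpa using hy i (mem_insert_self _ _)
    refine ⟨hi, q, hqT, fun j hj => ?_⟩
    by_cases hji : j = i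
    · subst hji
      rw [hi, hq hj]
    · simpa [hji] using hy j (mem_insert_of_mem hj)
  · rintro ⟨hi, q, hqT, hy⟩
    refine ⟨_, mem_image_of_mem _ (mem_filter.2 ⟨hqT, fun h => (hy i h).symm.trans hi⟩),
      fun j hj => ?_⟩
    by_cases hji : j = i
    · subst hji
      simpa using hi
    · simpa [hji] using hy j (mem_of_mem_insert_of_ne hj hji)

/-- A decision tree is the disjunction of the terms read off its accepting leaves. -/
theorem DecisionTree.exists_terms {m : ℕ} (t : DecisionTree m) :
    ∃ T : Finset (Finset (Fin m) × (Fin m → Bool)), #T ≤ 2 ^ t.depth ∧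
      (∀ p ∈ T, #p.1 ≤ t.depth) ∧
      ∀ y : Fin m → Bool, (∃ p ∈ T, ∀ j ∈ p.1, y j = p.2 j) ↔ t.eval y = true := by
  induction t with
  | leaf b =>
    cases b
    · exact ⟨∅, by simp, by simp, by simp [DecisionTree.eval]⟩
    · exact ⟨{(∅, fun _ => true)}, by simp [DecisionTree.depth], by simp,
        by simp [DecisionTree.eval]⟩
  | query i t₀ t₁ ih₀ ih₁ =>
    obtain ⟨T₀, hc₀, hd₀, hT₀⟩ := ih₀
    obtain ⟨T₁, hc₁, hd₁, hT₁⟩ := ih₁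
    obtain ⟨S₀, hs₀, he₀, hS₀⟩ := exists_terms_and_bit i false T₀
    obtain ⟨S₁, hs₁, he₁, hS₁⟩ := exists_terms_and_bit i true T₁
    refine ⟨S₀ ∪ S₁, ?_, fun p hp => ?_, fun y => ?_⟩
    · have h₀ : 2 ^ t₀.depth ≤ 2 ^ max t₀.depth t₁.depth :=
        Nat.pow_le_pow_right (by norm_num) (le_max_left _ _)
      have h₁ : 2 ^ t₁.depth ≤ 2 ^ max t₀.depth t₁.depth :=
        Nat.pow_le_pow_right (by norm_num) (le_max_right _ _)
      have := card_union_le S₀ S₁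
      rw [DecisionTree.depth, pow_succ]
      omega
    · rw [DecisionTree.depth]
      rcases mem_union.1 hp with h | h
      · exact he₀ _ (fun p hp => (hd₀ p hp).trans (le_max_left _ _)) p h
      · exact he₁ _ (fun p hp => (hd₁ p hp).trans (le_max_right _ _)) p h
    · simp only [mem_union, or_and_right, exists_or, hS₀, hS₁, hT₀, hT₁, DecisionTree.eval]
      cases y i <;> simp

/-- The set of positions of the ones of a bit string. -/
def onesSet {n : ℕ} (x : Fin n → Bool) : Finset (Fin n) := univ.filter fun i => x i = true

theorem mem_onesSet {n : ℕ} {x : Fin n → Bool} {i : Fin n} : i ∈ onesSet x ↔ x i = true := by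
  simp [onesSet]

theorem card_onesSet {n : ℕ} (x : Fin n → Bool) : #(onesSet x) = hammingWeight x := rfl

theorem mem_hammingSlice {n k : ℕ} {x : Fin n → Bool} :
    x ∈ hammingSlice n k ↔ #(onesSet x) = k := by
  simp [hammingSlice, card_onesSet]

/-- The outputs of weight at most `k` of a shallow decision forest are essentially confined to a
small set of coordinates. -/
theorem exists_small_set_of_hasDecisionDepth {m n : ℕ} {f : (Fin m → Bool) → (Fin n → Bool)}
    {D : ℕ} {R : ℝ} (hf : HasDecisionDepth f D) (hD : 1 ≤ D) (hDR : (D : ℝ) ≤ R) (k : ℕ) :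
    ∃ J : Finset (Fin n), (#J : ℝ) < 4 ^ D * R ^ (D + 1) ∧
      𝔼 y : Fin m → Bool, (if hammingWeight (f y) ≤ k ∧ ¬ onesSet (f y) ⊆ J
        then (1 : ℝ) else 0) ≤ n * 2 ^ D * (2 ^ k * Real.exp (-(R / (16 * D)))) := by
  choose t ht hft using hf
  choose T hcT hdT hT using fun j => (t j).exists_terms
  set S : Finset (Fin n × Finset (Fin m) × (Fin m → Bool)) :=
    univ.biUnion fun j => (T j).image fun p => (j, p) with hS
  have hmem : ∀ p, p ∈ S ↔ p.2 ∈ T p.1 := by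
    rintro ⟨j, p⟩
    simp [hS]
  have hcS : (#S : ℝ) ≤ n * 2 ^ D := by
    have h1 : #S ≤ ∑ _j : Fin n, 2 ^ D := card_biUnion_le.trans (sum_le_sum fun j _ =>
      card_image_le.trans ((hcT j).trans (Nat.pow_le_pow_right (by norm_num) (ht j))))
    rw [sum_const, card_univ, Fintype.card_fin, smul_eq_mul] at h1
    exact_mod_cast h1
  obtain ⟨J, hJ, hE⟩ := exists_small_set_of_terms (W := fun y => onesSet (f y)) hD hDR k S
    (fun p hp => (hdT p.1 p.2 ((hmem p).1 hp)).trans (ht p.1)) (fun p hp y hy => by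
      rw [mem_onesSet, ← hft]
      exact (hT p.1 y).1 ⟨p.2, (hmem p).1 hp, hy⟩)
  refine ⟨J, hJ, le_trans (expect_le_expect fun y _ => ?_)
    (hE.trans (mul_le_mul_of_nonneg_right hcS (by positivity)))⟩
  split_ifs with h1 h2
  · exact le_rfl
  · refine absurd ⟨h1.1, ?_⟩ h2
    obtain ⟨j, hj, hjJ⟩ := not_subset.1 h1.2
    rw [mem_onesSet, ← hft] at hj
    obtain ⟨p, hp, hpy⟩ := (hT j y).2 hj
    exact ⟨(j, p), (hmem _).2 hp, hjJ, hpy⟩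
  · exact zero_le_one
  · exact le_rfl

/-! ### Statistical distance from the slice -/

theorem sum_sub_le_statDist {α : Type*} [Fintype α] (p q : PMF α) (A : Finset α) :
    ∑ a ∈ A, (q a).toReal - ∑ a ∈ A, (p a).toReal ≤ statDist p q := by
  classical
  have hone : ∀ r : PMF α, ∑ a, (r a).toReal = 1 := fun r => by
    rw [← ENNReal.toReal_sum fun a _ => r.apply_ne_top a, ← tsum_fintype (L := .unconditional _),
      r.tsum_coe,
      ENNReal.toReal_one]
  have hp := sum_add_sum_compl A fun a => (p a).toReal
  have hq := sum_add_sum_compl A fun a => (q a).toReal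
  rw [hone] at hp hq
  have h1 : ∑ a ∈ A, (q a).toReal - ∑ a ∈ A, (p a).toReal
      ≤ ∑ a ∈ A, |(p a).toReal - (q a).toReal| := by
    rw [← sum_sub_distrib]
    exact sum_le_sum fun a _ => (le_abs_self _).trans_eq (abs_sub_comm _ _)
  have h2 : ∑ a ∈ Aᶜ, (p a).toReal - ∑ a ∈ Aᶜ, (q a).toReal
      ≤ ∑ a ∈ Aᶜ, |(p a).toReal - (q a).toReal| := by
    rw [← sum_sub_distrib]
    exact sum_le_sum fun a _ => le_abs_self _
  have h3 := sum_add_sum_compl A fun a => |(p a).toReal - (q a).toReal|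
  rw [statDist]
  linarith

theorem statDist_nonneg {α : Type*} [Fintype α] (p q : PMF α) : 0 ≤ statDist p q :=
  mul_nonneg (by norm_num) (sum_nonneg fun _ _ => abs_nonneg _)

theorem samplerOutput_apply {m n : ℕ} (f : (Fin m → Bool) → (Fin n → Bool)) (x : Fin n → Bool) :
    (samplerOutput f x).toReal = 𝔼 y, (if x = f y then (1 : ℝ) else 0) := by
  rw [samplerOutput, PMF.map_apply, tsum_fintype, ENNReal.toReal_sum, Fintype.expect_eq_sum_div_card,
    sum_div]
  · refine sum_congr rfl fun y _ => ?_
    split_ifs <;> simp [PMF.uniformOfFintype_apply]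
  · intro y _
    split_ifs
    · exact PMF.apply_ne_top _ _
    · exact ENNReal.zero_ne_top

theorem sum_samplerOutput {m n : ℕ} (f : (Fin m → Bool) → (Fin n → Bool))
    (A : Finset (Fin n → Bool)) :
    ∑ x ∈ A, (samplerOutput f x).toReal = 𝔼 y, (if f y ∈ A then (1 : ℝ) else 0) := by
  simp_rw [samplerOutput_apply]
  rw [← expect_sum_comm]
  exact expect_congr rfl fun y _ => by rw [sum_ite_eq']

theorem card_slice_filter_onesSet_subset {n : ℕ} (k : ℕ) (J : Finset (Fin n)) :
    #{x ∈ hammingSlice n k | onesSet x ⊆ J} = (#J).choose k := by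
  rw [← card_powersetCard]
  refine card_bij (fun x _ => onesSet x) (fun x hx => ?_) (fun x _ y _ h => ?_) fun s hs => ?_
  · have := mem_filter.1 hx
    exact mem_powersetCard.2 ⟨this.2, mem_hammingSlice.1 this.1⟩
  · ext i
    have := Finset.ext_iff.1 h i
    rw [mem_onesSet, mem_onesSet] at this
    exact Bool.eq_iff_iff.2 this
  · have hs' : onesSet (fun i => decide (i ∈ s)) = s := by ext i; simp [mem_onesSet]
    have := mem_powersetCard.1 hs
    refine ⟨fun i => decide (i ∈ s), mem_filter.2 ⟨mem_hammingSlice.2 ?_, ?_⟩, hs'⟩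
    · rw [hs', this.2]
    · rw [hs']; exact this.1

theorem card_hammingSlice (n k : ℕ) : #(hammingSlice n k) = n.choose k := by
  have := card_slice_filter_onesSet_subset k (univ : Finset (Fin n))
  simpa using this

theorem choose_mul_pow_le {a n : ℕ} (h : a ≤ n) (k : ℕ) :
    a.choose k * n ^ k ≤ n.choose k * a ^ k := by
  have key : ∀ k, a.descFactorial k * n ^ k ≤ n.descFactorial k * a ^ k := by
    intro k
    induction k with
    | zero => simp
    | succ k ih =>
      have h1 : (a - k) * n ≤ (n - k) * a := by
        rw [Nat.sub_mul, Nat.sub_mul, mul_comm n a]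
        exact Nat.sub_le_sub_left (Nat.mul_le_mul_left k h) _
      calc a.descFactorial (k + 1) * n ^ (k + 1)
          = ((a - k) * n) * (a.descFactorial k * n ^ k) := by rw [Nat.descFactorial_succ]; ring
        _ ≤ ((n - k) * a) * (n.descFactorial k * a ^ k) := Nat.mul_le_mul h1 ih
        _ = n.descFactorial (k + 1) * a ^ (k + 1) := by rw [Nat.descFactorial_succ]; ring
  have := key k
  rw [Nat.descFactorial_eq_factorial_mul_choose, Nat.descFactorial_eq_factorial_mul_choose,
    mul_assoc, mul_assoc] at this
  exact Nat.le_of_mul_le_mul_left this k.factorial_pos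

/-- The slice puts most of its mass on strings not supported in a small set `J`, and the forest puts
little mass there. -/
theorem statDist_samplerOutput_ge {m n : ℕ} {f : (Fin m → Bool) → (Fin n → Bool)}
    {D : ℕ} {R : ℝ} (hf : HasDecisionDepth f D) (hD : 1 ≤ D) (hDR : (D : ℝ) ≤ R) {k : ℕ}
    (hkn : k ≤ n) (hn : 1 ≤ n) :
    1 - (4 ^ D * R ^ (D + 1) / n) ^ k - n * 2 ^ D * (2 ^ k * Real.exp (-(R / (16 * D))))
      ≤ statDist (samplerOutput f) (uniformSlice n k hkn) := by
  obtain ⟨J, hJ, hE⟩ := exists_small_set_of_hasDecisionDepth hf hD hDR k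
  set A := (hammingSlice n k).filter fun x => ¬ onesSet x ⊆ J with hA
  refine le_trans ?_ (sum_sub_le_statDist _ _ A)
  have hn' : (0 : ℝ) < n := by exact_mod_cast hn
  have hc : (0 : ℝ) < n.choose k := by exact_mod_cast Nat.choose_pos hkn
  have h1 : ∑ x ∈ A, (samplerOutput f x).toReal
      ≤ n * 2 ^ D * (2 ^ k * Real.exp (-(R / (16 * D)))) := by
    rw [sum_samplerOutput]
    refine le_trans (expect_le_expect fun y _ => ?_) hE
    split_ifs with h1 h2
    · exact le_rfl
    · have h3 := mem_filter.1 h1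
      exact absurd ⟨(mem_hammingSlice.1 h3.1).le, h3.2⟩ h2
    · exact zero_le_one
    · exact le_rfl
  have h2 : ∑ x ∈ A, (uniformSlice n k hkn x).toReal = #A / n.choose k := by
    have : ∀ x ∈ A, (uniformSlice n k hkn x).toReal = (n.choose k : ℝ)⁻¹ := fun x hx => by
      rw [uniformSlice, PMF.uniformOfFinset_apply_of_mem _ (mem_filter.1 hx).1, card_hammingSlice]
      simp
    rw [sum_congr rfl this, sum_const, nsmul_eq_mul, div_eq_mul_inv]
  have h3 : ((#J).choose k : ℝ) + #A = n.choose k := by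
    have := card_filter_add_card_filter_not (s := hammingSlice n k) fun x => onesSet x ⊆ J
    rw [card_slice_filter_onesSet_subset, card_hammingSlice] at this
    exact_mod_cast this
  have h4 : ((#J).choose k : ℝ) / n.choose k ≤ (4 ^ D * R ^ (D + 1) / n) ^ k := by
    have hJn : #J ≤ n := by simpa using card_le_univ J
    refine le_trans ?_ (pow_le_pow_left₀ (by positivity) (div_le_div_of_nonneg_right hJ.le hn'.le) k)
    rw [div_pow, div_le_div_iff₀ hc (by positivity)]
    have := choose_mul_pow_le hJn k
    rw [mul_comm ((#J : ℝ) ^ k)]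
    exact_mod_cast this
  have h5 : (#A : ℝ) / n.choose k = 1 - (#J).choose k / n.choose k := by
    rw [← h3] at hc ⊢
    field_simp
    ring
  rw [h2, h5]
  linarith

/-! ### Choice of parameters -/

/-- The estimate behind both parameter ranges; `2 ^ s` plays the role of `max k (log n)`. -/
theorem isFar_of_exponent_le {m n k d : ℕ} {f : (Fin m → Bool) → (Fin n → Bool)} {s : ℝ}
    (hf : HasDecisionDepth f d) (hk : 1 ≤ k) (hkn : k ≤ n) (hl : 100 ≤ Real.logb 2 n)
    (hR : 160 * ((d : ℝ) + 1) * (k + 1) * Real.logb 2 n ≤ (2 : ℝ) ^ (5 * s))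
    (hs : s ≤ Real.logb 2 n / 100) (hds : d * s ≤ Real.logb 2 n / 100)
    (hd : (d : ℝ) ≤ Real.logb 2 n / 100) :
    IsFar (1 - (n : ℝ) ^ (-(1 / 4 * k : ℝ))) (samplerOutput f) (uniformSlice n k hkn) := by
  set l := Real.logb 2 n with hldef
  have hn : 1 ≤ n := hk.trans hkn
  have hn₀ : (0 : ℝ) < n := by exact_mod_cast hn
  have hk₁ : (1 : ℝ) ≤ k := by exact_mod_cast hk
  have hd₀ : (0 : ℝ) ≤ d := Nat.cast_nonneg d
  have hkl : l ≤ k * l := le_mul_of_one_le_left (by linarith) hk₁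
  have hnl : (n : ℝ) = 2 ^ l := (Real.rpow_logb (by norm_num) (by norm_num) hn₀).symm
  have hf' : HasDecisionDepth f (d + 1) := fun j => by
    obtain ⟨t, ht, h⟩ := hf j
    exact ⟨t, ht.trans (Nat.le_succ d), h⟩
  set R := 160 * ((d : ℝ) + 1) * (k + 1) * l with hRdef
  have hR₀ : 0 ≤ R := by positivity
  have hDR : ((d + 1 : ℕ) : ℝ) ≤ R := by
    push_cast
    have h1 : (1 : ℝ) ≤ 160 * ((k + 1) * l) := by nlinarith
    calc (d : ℝ) + 1 ≤ ((d : ℝ) + 1) * (160 * ((k + 1) * l)) :=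
          le_mul_of_one_le_right (by positivity) h1
      _ = R := by rw [hRdef]; ring
  refine le_trans ?_ (statDist_samplerOutput_ge hf' (Nat.le_add_left 1 d) hDR hkn hn)
  -- Both error terms are at most `n ^ (-k / 2)`; the exponent `k / 4` absorbs their sum.
  have hM : (4 : ℝ) ^ (d + 1) * R ^ (d + 1 + 1) ≤ 2 ^ (l / 2) := by
    have h1 : R ^ (d + 1 + 1) ≤ (2 : ℝ) ^ (5 * s * (d + 2)) := by
      refine (pow_le_pow_left₀ hR₀ hR _).trans_eq ?_
      rw [← Real.rpow_natCast, ← Real.rpow_mul (by norm_num)]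
      push_cast
      ring_nf
    have h2 : (4 : ℝ) ^ (d + 1) = 2 ^ (2 * ((d : ℝ) + 1)) := by
      rw [Real.rpow_mul (by norm_num), ← Nat.cast_succ, Real.rpow_natCast]
      norm_num
    rw [h2]
    refine (mul_le_mul_of_nonneg_left h1 (by positivity)).trans ?_
    rw [← Real.rpow_add (by norm_num)]
    refine Real.rpow_le_rpow_of_exponent_le (by norm_num) ?_
    nlinarith
  have hsmall : ((4 : ℝ) ^ (d + 1) * R ^ (d + 1 + 1) / n) ^ k ≤ 2 ^ (-(k * l / 2)) := by
    have h1 : (4 : ℝ) ^ (d + 1) * R ^ (d + 1 + 1) / n ≤ 2 ^ (-(l / 2)) := by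
      rw [div_le_iff₀ hn₀, hnl, ← Real.rpow_add (by norm_num)]
      refine hM.trans_eq ?_
      ring_nf
    refine (pow_le_pow_left₀ (by positivity) h1 k).trans_eq ?_
    rw [← Real.rpow_natCast, ← Real.rpow_mul (by norm_num)]
    ring_nf
  have hrare : (n : ℝ) * 2 ^ (d + 1) * (2 ^ k * Real.exp (-(R / (16 * (d + 1 : ℕ)))))
      ≤ 2 ^ (-(k * l / 2)) := by
    have h1 : R / (16 * (d + 1 : ℕ)) = 10 * (k + 1) * l := by
      rw [hRdef]
      push_cast
      field_simp
      ring
    have h2 : Real.exp (-(10 * (k + 1) * l)) ≤ 2 ^ (-(10 * (k + 1) * l)) := by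
      rw [Real.rpow_def_of_pos (by norm_num)]
      refine Real.exp_le_exp.2 ?_
      have := Real.log_two_lt_d9
      have : (0 : ℝ) ≤ 10 * (k + 1) * l := by positivity
      nlinarith
    rw [h1]
    calc (n : ℝ) * 2 ^ (d + 1) * (2 ^ k * Real.exp (-(10 * (k + 1) * l)))
        ≤ n * 2 ^ (d + 1) * (2 ^ k * 2 ^ (-(10 * (k + 1) * l))) := by gcongr
      _ = 2 ^ (l + (d + 1) + (k + -(10 * (k + 1) * l))) := by
          rw [Real.rpow_add (by norm_num), Real.rpow_add (by norm_num),
            Real.rpow_add (by norm_num) (k : ℝ), ← hnl, ← Nat.cast_succ d, Real.rpow_natCast,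
            Real.rpow_natCast]
      _ ≤ 2 ^ (-(k * l / 2)) := by
          refine Real.rpow_le_rpow_of_exponent_le (by norm_num) ?_
          nlinarith
  have htwo : (2 : ℝ) ^ (-(k * l / 2)) + 2 ^ (-(k * l / 2)) ≤ (n : ℝ) ^ (-(1 / 4 * k : ℝ)) := by
    rw [← two_mul, hnl, ← Real.rpow_mul (by norm_num)]
    nth_rewrite 1 [← Real.rpow_one 2]
    rw [← Real.rpow_add (by norm_num)]
    refine Real.rpow_le_rpow_of_exponent_le (by norm_num) ?_
    linarith
  linarith

theorem eventually_logb_bounds {ε : ℝ} (hε : 0 < ε) :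
    ∀ᶠ n : ℕ in Filter.atTop, 100 ≤ Real.logb 2 n ∧ 100 ≤ Real.logb 2 n ^ ε ∧
      Real.logb 2 (Real.logb 2 n) ≤ Real.logb 2 n / 100 := by
  have hl : Filter.Tendsto (fun n : ℕ => Real.logb 2 n) Filter.atTop Filter.atTop :=
    (Real.tendsto_logb_atTop (by norm_num)).comp tendsto_natCast_atTop_atTop
  have hlog : ∀ᶠ x : ℝ in Filter.atTop, Real.logb 2 x ≤ x / 100 := by
    have hc : (0 : ℝ) < Real.log 2 / 100 := div_pos (Real.log_pos (by norm_num)) (by norm_num)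
    filter_upwards [Real.isLittleO_log_id_atTop.bound hc, Filter.eventually_ge_atTop 0] with x hx hx₀
    have h1 : Real.log x ≤ Real.log 2 / 100 * x := by
      refine (le_abs_self _).trans (hx.trans_eq ?_)
      rw [id, Real.norm_of_nonneg hx₀]
    rw [Real.logb, div_le_iff₀ (Real.log_pos (by norm_num))]
    linarith
  exact ((hl.eventually_ge_atTop 100).and
    ((((tendsto_rpow_atTop hε).comp hl).eventually_ge_atTop 100).and (hl.eventually hlog)))

theorem isFar_of_logb_le {m n k d : ℕ} {f : (Fin m → Bool) → (Fin n → Bool)} {ε : ℝ}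
    (hf : HasDecisionDepth f d) (hkn : k ≤ n) (hε₁ : ε < 1)
    (hl : 100 ≤ Real.logb 2 n) (hlε : 100 ≤ Real.logb 2 n ^ ε) (hk : Real.logb 2 n ≤ k)
    (hk' : (k : ℝ) ≤ (2 : ℝ) ^ (Real.logb 2 n ^ (1 - ε)))
    (hd : (d : ℝ) ≤ 1 / 100 * Real.logb 2 n ^ ε) :
    IsFar (1 - (n : ℝ) ^ (-(1 / 4 * k : ℝ))) (samplerOutput f) (uniformSlice n k hkn) := by
  set l := Real.logb 2 n with hldef
  have hk₁₀₀ : (100 : ℝ) ≤ k := hl.trans hk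
  have hk₀ : (0 : ℝ) < k := by linarith
  have hmul : l ^ ε * l ^ (1 - ε) = l := by
    rw [← Real.rpow_add (by linarith), add_sub_cancel, Real.rpow_one]
  have hs : Real.logb 2 k ≤ l ^ (1 - ε) :=
    (Real.logb_le_iff_le_rpow (by norm_num) hk₀).2 hk'
  have hlε' : l ^ ε ≤ l := by
    have := Real.rpow_le_rpow_of_exponent_le (by linarith : 1 ≤ l) hε₁.le
    rwa [Real.rpow_one] at this
  have hpos : 0 ≤ l ^ (1 - ε) := Real.rpow_nonneg (by linarith) _
  have hdl : (d : ℝ) ≤ l / 100 := by linarith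
  refine isFar_of_exponent_le (s := Real.logb 2 k) hf ?_ hkn hl ?_ ?_ ?_ hdl
  · exact_mod_cast (by linarith : (1 : ℝ) ≤ k)
  · have h1 : (2 : ℝ) ^ (5 * Real.logb 2 k) = (k : ℝ) ^ 5 := by
      rw [mul_comm, Real.rpow_mul (by norm_num), Real.rpow_logb (by norm_num) (by norm_num) hk₀]
      exact Real.rpow_ofNat _ 5
    rw [h1, ← hldef]
    calc 160 * ((d : ℝ) + 1) * (k + 1) * l ≤ 160 * k * (2 * k) * k := by
          gcongr <;> linarith
      _ = 320 * (k : ℝ) ^ 3 := by ring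
      _ ≤ (k : ℝ) ^ 2 * (k : ℝ) ^ 3 := by gcongr; nlinarith
      _ = (k : ℝ) ^ 5 := by ring
  · refine hs.trans ?_
    rw [← hldef]
    nlinarith
  · calc (d : ℝ) * Real.logb 2 k ≤ (1 / 100 * l ^ ε) * l ^ (1 - ε) := by
          refine (mul_le_mul_of_nonneg_left hs (Nat.cast_nonneg d)).trans ?_
          exact mul_le_mul_of_nonneg_right hd hpos
      _ = l / 100 := by rw [mul_assoc, hmul]; ring

theorem isFar_of_lt_logb {m n k d : ℕ} {f : (Fin m → Bool) → (Fin n → Bool)} {ε : ℝ}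
    (hf : HasDecisionDepth f d) (hk : 1 ≤ k) (hkn : k ≤ n) (hε₁ : ε < 1)
    (hl : 100 ≤ Real.logb 2 n) (hll : Real.logb 2 (Real.logb 2 n) ≤ Real.logb 2 n / 100)
    (hk' : (k : ℝ) < Real.logb 2 n)
    (hd : (d : ℝ) ≤ 1 / 100 * Real.logb 2 n ^ ε / Real.logb 2 (Real.logb 2 n)) :
    IsFar (1 - (n : ℝ) ^ (-(1 / 4 * k : ℝ))) (samplerOutput f) (uniformSlice n k hkn) := by
  set l := Real.logb 2 n with hldef
  have hl₀ : 0 < l := by linarith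
  have hs : 1 ≤ Real.logb 2 l := by
    rw [Real.le_logb_iff_rpow_le (by norm_num) hl₀, Real.rpow_one]
    linarith
  have hlε' : l ^ ε ≤ l := by
    have := Real.rpow_le_rpow_of_exponent_le (by linarith : 1 ≤ l) hε₁.le
    rwa [Real.rpow_one] at this
  have hds : (d : ℝ) * Real.logb 2 l ≤ l / 100 := by
    rw [le_div_iff₀ (by linarith)] at hd
    linarith
  have hdl : (d : ℝ) ≤ l / 100 :=
    (le_mul_of_one_le_right (Nat.cast_nonneg d) hs).trans hds
  refine isFar_of_exponent_le (s := Real.logb 2 l) hf hk hkn hl ?_ hll hds hdl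
  have h1 : (2 : ℝ) ^ (5 * Real.logb 2 l) = l ^ 5 := by
    rw [mul_comm, Real.rpow_mul (by norm_num), Real.rpow_logb (by norm_num) (by norm_num) hl₀]
    exact Real.rpow_ofNat _ 5
  rw [h1, ← hldef]
  calc 160 * ((d : ℝ) + 1) * (k + 1) * l ≤ 160 * l * (2 * l) * l := by
        gcongr <;> linarith
    _ = 320 * l ^ 3 := by ring
    _ ≤ l ^ 2 * l ^ 3 := by gcongr; nlinarith
    _ = l ^ 5 := by ring

theorem mainTheorem6 :
    ∃ τ' : ℝ, 0 < τ' ∧ ∃ c : ℝ, 0 < c ∧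
      ∀ ε : ℝ, 0 < ε → ε < 1 →
        ∃ n₀ : ℕ, ∀ n : ℕ, n₀ ≤ n → ∀ (k : ℕ) (hkn : k ≤ n) (d m : ℕ)
          (f : (Fin m → Bool) → (Fin n → Bool)), HasDecisionDepth f d →
          (Real.logb 2 n ≤ k → (k : ℝ) ≤ (2 : ℝ) ^ (Real.logb 2 n ^ (1 - ε)) →
            (d : ℝ) ≤ τ' * Real.logb 2 n ^ ε →
            IsFar (1 - (n : ℝ) ^ (-(c * k))) (samplerOutput f) (uniformSlice n k hkn)) ∧
          ((k : ℝ) < Real.logb 2 n →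
            (d : ℝ) ≤ τ' * Real.logb 2 n ^ ε / Real.logb 2 (Real.logb 2 n) →
            IsFar (1 - (n : ℝ) ^ (-(c * k))) (samplerOutput f) (uniformSlice n k hkn)) := by
  refine ⟨1 / 100, by norm_num, 1 / 4, by norm_num, fun ε hε hε₁ => ?_⟩
  obtain ⟨n₀, hn₀⟩ := Filter.eventually_atTop.1 (eventually_logb_bounds hε)
  refine ⟨n₀, fun n hn k hkn d m f hf => ?_⟩
  obtain ⟨hl, hlε, hll⟩ := hn₀ n hn
  refine ⟨fun hk hk' hd => isFar_of_logb_le hf hkn hε₁ hl hlε hk hk' hd, fun hk hd => ?_⟩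
  rcases Nat.eq_zero_or_pos k with rfl | hk₀
  · -- For `k = 0` the claimed distance is `0`.
    have h0 := statDist_nonneg (samplerOutput f) (uniformSlice n 0 hkn)
    simpa [IsFar] using h0
  · exact isFar_of_lt_logb hf hk₀ hkn hε₁ hl hll hk hd
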